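/- Let $\Gamma$ be a finitely generated group and $n$ a natural number. Let $\mathcal X_{\mathrm{GL}(n,\mathbb C)}(\Gamma)=\mathrm{Hom}(\Gamma,\mathrm{GL}(n,\mathbb C))/\!/\mathrm{GL}(n,\mathbb C)$ be the character variety, i.e. the set of complex points of the spectrum of the ring of conjugation-invariant regular functions on $\mathrm{Hom}(\Gamma,\mathrm{GL}(n,\mathbb C))$; write $\chi_\rho$ for the image of a representation $\rho$ in it, and let $\Phi_1$ be the anti-holomorphic involution of $\mathcal X_{\mathrm{GL}(n,\mathbb C)}(\Gamma)$ induced by complex conjugation $A\mapsto\overline A$, so that $\Phi_1(\chi_\rho)=\chi_{\overline\rho}$. For $m\in\mathbb N$ let $$\mathrm{GL}(m,\mathbb H)=\{M\in\mathrm{GL}(2m,\mathbb C)\mid MJ=J\overline M\},\qquad J=\begin{pmatrix}0&I_m\\-I_m&0\end{pmatrix}.$$ Let $\rho\in\mathrm{Hom}(\Gamma,\mathrm{GL}(n,\mathbb C))$ be a semisimple representation (that is, $\mathbb C^n$ is a direct sum of irreducible subrepresentations). If $\Phi_1(\chi_\rho)=\chi_\rho$, then there exist $r_1,r_2\in\mathbb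 N$ (possibly zero) with $r_1+2r_2=n$, $\rho'\in\mathrm{Hom}(\Gamma,\mathrm{GL}(r_1,\mathbb R))$ and $\rho''\in\mathrm{Hom}(\Gamma,\mathrm{GL}(r_2,\mathbb H))$ such that $\rho$ is conjugate in $\mathrm{GL}(n,\mathbb C)$ to the block-diagonal representation $\rho'\oplus\rho''$. -/

import Mathlib

/-! ### The representation variety and its ring of regular functions -/

/-- The set `Hom(Γ, GL(n, ℂ))` of representations of `Γ` in `GL(n, ℂ)`. -/
abbrev GLRep (Γ : Type*) [Group Γ] (n : ℕ) : Type _ :=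
  Γ →* Matrix.GeneralLinearGroup (Fin n) ℂ

namespace GLRep

variable {Γ : Type*} [Group Γ] {n : ℕ}

/-- The representation `P ρ P⁻¹`. -/
def conjBy (P : Matrix.GeneralLinearGroup (Fin n) ℂ) (ρ : GLRep Γ n) : GLRep Γ n :=
  (MulAut.conj P).toMonoidHom.comp ρ

/-- The complex conjugate representation `γ ↦ conj (ρ γ)` (entrywise conjugation). -/
def complexConj (ρ : GLRep Γ n) : GLRep Γ n :=
  (Matrix.GeneralLinearGroup.map (starRingEnd ℂ)).comp ρ

/-- The linear representation of `Γ` on `ℂⁿ` given by a homomorphism `Γ → GL(n, ℂ)`. -/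
def toRepresentation (ρ : GLRep Γ n) : Representation ℂ Γ (Fin n → ℂ) where
  toFun γ := Matrix.toLin' (ρ γ : Matrix (Fin n) (Fin n) ℂ)
  map_one' := by
    rw [map_one, Units.val_one, Matrix.toLin'_one]
    rfl
  map_mul' γ δ := by
    rw [map_mul, Units.val_mul, Matrix.toLin'_mul]
    rfl

/-- `ρ` is semisimple: the representation it defines on `ℂⁿ` is semisimple. -/
def IsSemisimple (ρ : GLRep Γ n) : Prop :=
  (toRepresentation ρ).IsSemisimpleRepresentation

variable (Γ n) in
/-- The coordinate ring `ℂ[Hom(Γ, GL(n, ℂ))]`: the algebra of functions on `Hom(Γ, GL(n, ℂ))`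
generated by the matrix coefficients `ρ ↦ (ρ γ) i j`, `γ ∈ Γ`. If `γ₁, …, γₛ` generate `Γ`, it is
the algebra of restrictions of regular functions under the embedding
`ρ ↦ (ρ γ₁, …, ρ γₛ)` in `GL(n, ℂ)ˢ`: the entries of `ρ γ` are polynomials in the entries of the
`ρ γₖ` and of their inverses, and `(det (ρ γ))⁻¹` is a polynomial in the entries of `ρ γ⁻¹`. -/
def regularFunctions : Subalgebra ℂ (GLRep Γ n → ℂ) :=
  Algebra.adjoin ℂ {f | ∃ (γ : Γ) (i j : Fin n),
    f = fun ρ => (ρ γ : Matrix (Fin n) (Fin n) ℂ) i j}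

variable (Γ n) in
/-- The algebra `ℂ[Hom(Γ, GL(n, ℂ))]^{GL(n, ℂ)}` of regular functions that are invariant under
conjugation by `GL(n, ℂ)`. -/
def invariantFunctions : Subalgebra ℂ (GLRep Γ n → ℂ) where
  carrier := {f | f ∈ regularFunctions Γ n ∧
    ∀ (P : Matrix.GeneralLinearGroup (Fin n) ℂ) (ρ : GLRep Γ n), f (conjBy P ρ) = f ρ}
  mul_mem' {f g} hf hg := ⟨mul_mem hf.1 hg.1, fun P ρ => by
    simp only [Pi.mul_apply, hf.2 P ρ, hg.2 P ρ]⟩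
  add_mem' {f g} hf hg := ⟨add_mem hf.1 hg.1, fun P ρ => by
    simp only [Pi.add_apply, hf.2 P ρ, hg.2 P ρ]⟩
  algebraMap_mem' c := ⟨algebraMap_mem _ c, fun _ _ => rfl⟩

/-! ### The character variety -/

variable (Γ n) in
/-- The `GL(n, ℂ)`-character variety of `Γ`, i.e. the GIT quotient
`Hom(Γ, GL(n, ℂ)) // GL(n, ℂ)` as a set: the complex points of the spectrum of the ring of
invariant functions. -/
abbrev CharacterVariety : Type _ := invariantFunctions Γ n →ₐ[ℂ] ℂ

/-- The character `χ_ρ`: the image of `ρ` in the character variety, that is, evaluation of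
invariant functions at `ρ`. -/
def character (ρ : GLRep Γ n) : CharacterVariety Γ n :=
  (Pi.evalAlgHom ℂ (fun _ : GLRep Γ n => ℂ) ρ).comp (invariantFunctions Γ n).val

/-! ### The involution induced by complex conjugation -/

lemma complexConj_complexConj (ρ : GLRep Γ n) : complexConj (complexConj ρ) = ρ := by
  ext γ i j
  simp [complexConj]

lemma complexConj_conjBy (P : Matrix.GeneralLinearGroup (Fin n) ℂ) (ρ : GLRep Γ n) :
    complexConj (conjBy P ρ)
      = conjBy (Matrix.GeneralLinearGroup.map (starRingEnd ℂ) P) (complexConj ρ) := by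
  ext1 γ
  simp [complexConj, conjBy]

/-- For a function `f` on `Hom(Γ, GL(n, ℂ))`, the function `ρ ↦ conj (f (conj ρ))`. -/
def conjFun (f : GLRep Γ n → ℂ) : GLRep Γ n → ℂ :=
  fun ρ => starRingEnd ℂ (f (complexConj ρ))

lemma conjFun_mem_regularFunctions {f : GLRep Γ n → ℂ} (hf : f ∈ regularFunctions Γ n) :
    conjFun f ∈ regularFunctions Γ n := by
  unfold regularFunctions at hf
  induction hf using Algebra.adjoin_induction with
  | mem f hf =>
    obtain ⟨γ, i, j, rfl⟩ := hf
    refine Algebra.subset_adjoin ⟨γ, i, j, ?_⟩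
    funext ρ
    simp [conjFun, complexConj]
  | algebraMap c => exact algebraMap_mem (regularFunctions Γ n) (starRingEnd ℂ c)
  | add f g _ _ hf hg =>
    have h : conjFun (f + g) = conjFun f + conjFun g := by
      funext ρ
      simp [conjFun]
    rw [h]
    exact add_mem hf hg
  | mul f g _ _ hf hg =>
    have h : conjFun (f * g) = conjFun f * conjFun g := by
      funext ρ
      simp [conjFun]
    rw [h]
    exact mul_mem hf hg

lemma conjFun_mem_invariantFunctions {f : GLRep Γ n → ℂ} (hf : f ∈ invariantFunctions Γ n) :
    conjFun f ∈ invariantFunctions Γ n := by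
  refine ⟨conjFun_mem_regularFunctions hf.1, fun P ρ => ?_⟩
  simp only [conjFun, complexConj_conjBy]
  rw [hf.2]

/-- The anti-holomorphic involution `Φ₁` of the character variety induced by `A ↦ conj A`:
the point `χ` goes to the point `f ↦ conj (χ (ρ ↦ conj (f (conj ρ))))`. It is characterized on
characters of representations by `Φ₁ χ_ρ = χ_{conj ρ}`, see `Phi1_character`. -/
def Phi1 (χ : CharacterVariety Γ n) : CharacterVariety Γ n where
  toFun f := starRingEnd ℂ (χ ⟨conjFun f.1, conjFun_mem_invariantFunctions f.2⟩)
  map_one' := by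
    have h : (⟨conjFun (1 : invariantFunctions Γ n).1,
        conjFun_mem_invariantFunctions (1 : invariantFunctions Γ n).2⟩ :
        invariantFunctions Γ n) = 1 := by
      ext ρ
      simp [conjFun]
    rw [h, map_one, map_one]
  map_mul' f g := by
    rw [← map_mul, ← map_mul]
    congr 2
    ext ρ
    simp [conjFun]
  map_zero' := by
    have h : (⟨conjFun (0 : invariantFunctions Γ n).1,
        conjFun_mem_invariantFunctions (0 : invariantFunctions Γ n).2⟩ :
        invariantFunctions Γ n) = 0 := by
      ext ρ
      simp [conjFun]
    rw [h, map_zero, map_zero]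
  map_add' f g := by
    rw [← map_add, ← map_add]
    congr 2
    ext ρ
    simp [conjFun]
  commutes' c := by
    have h : (⟨conjFun (algebraMap ℂ (invariantFunctions Γ n) c).1,
        conjFun_mem_invariantFunctions (algebraMap ℂ (invariantFunctions Γ n) c).2⟩ :
        invariantFunctions Γ n) = algebraMap ℂ _ (starRingEnd ℂ c) := by
      ext ρ
      simp [conjFun, Algebra.algebraMap_eq_smul_one]
    rw [h, AlgHom.commutes]
    simp

/-- `Φ₁` is induced by complex conjugation of representations. -/
theorem Phi1_character (ρ : GLRep Γ n) : Phi1 (character ρ) = character (complexConj ρ) := by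
  ext f
  simp [Phi1, character, conjFun]

end GLRep

/-! ### Real and quaternionic linear groups, direct sums -/

/-- The matrix `J = (0, I; -I, 0)` of size `2m`. -/
def matrixJ (m : ℕ) : Matrix (Fin m ⊕ Fin m) (Fin m ⊕ Fin m) ℂ :=
  Matrix.fromBlocks 0 1 (-1) 0

/-- The group `GL(m, ℍ) = {M ∈ GL(2m, ℂ) | M J = J (conj M)}`. -/
def GLH (m : ℕ) : Subgroup (Matrix.GeneralLinearGroup (Fin m ⊕ Fin m) ℂ) where
  carrier := {M | (M : Matrix (Fin m ⊕ Fin m) (Fin m ⊕ Fin m) ℂ) * matrixJ m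
    = matrixJ m * (Matrix.GeneralLinearGroup.map (starRingEnd ℂ) M).val}
  one_mem' := by simp
  mul_mem' {M N} hM hN := by
    simp only [Set.mem_ofPred_eq] at hM hN ⊢
    rw [map_mul, Units.val_mul, Units.val_mul, Matrix.mul_assoc, hN, ← Matrix.mul_assoc, hM,
      Matrix.mul_assoc]
  inv_mem' {M} hM := by
    simp only [Set.mem_ofPred_eq] at hM ⊢
    rw [map_inv, Units.inv_mul_eq_iff_eq_mul, ← Matrix.mul_assoc, hM, Matrix.mul_assoc,
      Units.mul_inv, Matrix.mul_one]

/-- The block diagonal matrix `A ⊕ B` as a homomorphism `GL(m, ℂ) × GL(l, ℂ) → GL(m + l, ℂ)`,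
for index types `m`, `l`. -/
def blockDiagGL (m l : Type*) [Fintype m] [DecidableEq m] [Fintype l] [DecidableEq l] :
    Matrix.GeneralLinearGroup m ℂ × Matrix.GeneralLinearGroup l ℂ →*
      Matrix.GeneralLinearGroup (m ⊕ l) ℂ where
  toFun p :=
    { val := Matrix.fromBlocks p.1.val 0 0 p.2.val
      inv := Matrix.fromBlocks p.1⁻¹.val 0 0 p.2⁻¹.val
      val_inv := by simp [Matrix.fromBlocks_multiply, -Matrix.coe_units_inv]
      inv_val := by simp [Matrix.fromBlocks_multiply, -Matrix.coe_units_inv] }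
  map_one' := by
    ext1
    simp
  map_mul' p q := by
    ext1
    simp [Matrix.fromBlocks_multiply]

/-- The identification of the index set of blocks of sizes `r₁`, `r₂`, `r₂` with `Fin n`, when
`r₁ + 2 r₂ = n` (listing the blocks in order). -/
def blockIndexEquiv {n r₁ r₂ : ℕ} (h : r₁ + 2 * r₂ = n) :
    Fin r₁ ⊕ (Fin r₂ ⊕ Fin r₂) ≃ Fin n :=
  ((Equiv.sumCongr (Equiv.refl (Fin r₁)) finSumFinEquiv).trans finSumFinEquiv).trans
    (finCongr (by omega))

/-- The representation `ρ' ⊕ ρ''` of `Γ` in `GL(n, ℂ)`, for `ρ'` with values in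
`GL(r₁, ℝ) ⊆ GL(r₁, ℂ)`, `ρ''` with values in `GL(r₂, ℍ) ⊆ GL(2r₂, ℂ)` and `n = r₁ + 2r₂`. -/
def realQuaternionicSum {Γ : Type*} [Group Γ] {n r₁ r₂ : ℕ} (h : r₁ + 2 * r₂ = n)
    (ρ' : Γ →* Matrix.GeneralLinearGroup (Fin r₁) ℝ) (ρ'' : Γ →* GLH r₂) : GLRep Γ n :=
  (Units.mapEquiv (Matrix.reindexAlgEquiv ℂ ℂ (blockIndexEquiv h)).toMulEquiv).toMonoidHom.comp
    ((blockDiagGL (Fin r₁) (Fin r₂ ⊕ Fin r₂)).comp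
      (((Matrix.GeneralLinearGroup.map Complex.ofRealHom).comp ρ').prod
        ((GLH r₂).subtype.comp ρ'')))

/-! The traces of group elements are invariant functions, so a character fixed by `Phi1` has real
traces. Let A = ℂ[Γ], let σ conjugate coefficients, and regard V = ℂⁿ as a semisimple A-module. Real
traces say exactly that a and σ(a) have the same real trace on V (`TraceInvariant`). The aim is a
σ-semilinear T on V with T⁴ = 1. Then T² is linear and commutes with Γ, so V splits into the
eigenspaces T² = 1 and T² = -1. T is a real structure on the first and a quaternionic one on the
second; in an adapted basis, commuting with T means having a real block and a block in `GLH`.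

T is built by induction on dimension. Let S be simple in V. If σ(a) kills V then tr a = tr σ(a) = 0;
such a form a left ideal, and a left ideal of trace-zero elements kills S
(`smul_eq_zero_of_trace_eq_zero`). Hence S admits a nonzero σ-semilinear map f into V. Either f
preserves S, and Schur's lemma lets f be rescaled so that f² = ±1, or S and f(S) are independent and
exchanging them through f is an involution. The summand obtained has invariant trace, hence so has
its complement, and the induction continues there. -/

/-! ### Trace-zero left ideals and semilinear maps out of simple modules -/

open Polynomial in
/-- If an endomorphism `f` of a finite-dimensional space in characteristic zero has a nonzero fixed
vector, then some element `g * f` with `g` a polynomial in `f` has nonzero trace. -/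
theorem Module.End.exists_trace_aeval_mul_ne_zero {K V : Type*} [Field K] [CharZero K]
    [AddCommGroup V] [Module K V] [FiniteDimensional K V] (f : Module.End K V) {v : V}
    (hv : v ≠ 0) (hfv : f v = v) :
    ∃ p : K[X], LinearMap.trace K V (aeval f p * f) ≠ 0 := by
  obtain ⟨q, hq, hndvd⟩ := Polynomial.exists_eq_pow_rootMultiplicity_mul_and_not_dvd
    (minpoly K f) (minpoly.ne_zero (Algebra.IsIntegral.isIntegral f)) 1
  set m := (minpoly K f).rootMultiplicity 1
  -- Bézout yields the projection onto the generalized 1-eigenspace as a polynomial in `f`. The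
  -- extra factor `X` makes that polynomial divisible by `X`, as the form of the conclusion
  -- requires.
  have hcop : IsCoprime ((X - C (1 : K)) ^ m) (X * q) := by
    refine IsCoprime.pow_left (IsCoprime.mul_right ?_ ?_)
    · exact ⟨-1, 1, by rw [C_1]; ring⟩
    · exact (irreducible_X_sub_C (1 : K)).coprime_iff_not_dvd.2 hndvd
  obtain ⟨w, u, huw⟩ := hcop
  have hzero : aeval f ((X - C (1 : K)) ^ m * q) = 0 := by rw [← hq, minpoly.aeval]
  refine ⟨u * q, fun h0 => ?_⟩
  have hpe : aeval f (u * q) * f = aeval f (u * (X * q)) := by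
    rw [show u * (X * q) = (u * q) * X by ring, map_mul _ _ X, aeval_X]
  rw [hpe] at h0
  have hidem : IsIdempotentElem (aeval f (u * (X * q))) := by
    have h1 : u * (X * q) * (u * (X * q)) =
        u * (X * q) - u * X * w * ((X - C (1 : K)) ^ m * q) := by
      rw [show u * (X * q) * (u * (X * q)) =
        u * (X * q) * (w * (X - C 1) ^ m + u * (X * q)) -
          u * X * w * ((X - C (1 : K)) ^ m * q) by ring, huw, mul_one]
    rw [IsIdempotentElem, ← map_mul, h1, map_sub, map_mul _ (u * X * w), hzero, mul_zero, sub_zero]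
  -- In characteristic zero the trace of an idempotent determines its rank. The contradiction will
  -- be that this projection fixes `v`.
  have he := LinearMap.IsIdempotentElem.eq_zero_of_trace_eq_zero hidem h0
  have hm : m ≠ 0 := by
    rw [← Nat.pos_iff_ne_zero, Polynomial.rootMultiplicity_pos
      (minpoly.ne_zero (Algebra.IsIntegral.isIntegral f))]
    refine Module.End.isRoot_of_hasEigenvalue
      (Module.End.hasEigenvalue_of_hasEigenvector (x := v) ⟨?_, hv⟩)
    rw [Module.End.mem_eigenspace_iff, hfv, one_smul]
  have hev := Module.End.aeval_apply_of_hasEigenvector (f := f) (μ := 1) (x := v)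
    (p := u * (X * q)) ⟨by rw [Module.End.mem_eigenspace_iff, hfv, one_smul], hv⟩
  have h1 := congrArg (eval 1) huw
  rw [he] at hev
  simp only [eval_add, eval_mul, eval_pow, eval_sub, eval_X, eval_C, sub_self, zero_pow hm,
    mul_zero, zero_add, eval_one] at h1
  rw [show eval 1 (u * (X * q)) = 1 by simpa using h1, one_smul] at hev
  exact hv hev.symm

open Polynomial in
/-- A left ideal all of whose elements act with trace zero annihilates every simple submodule. -/
theorem smul_eq_zero_of_trace_eq_zero {K A V : Type*} [Field K] [CharZero K] [Ring A] [Algebra K A]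
    [AddCommGroup V] [Module K V] [Module A V] [IsScalarTower K A V] [FiniteDimensional K V]
    (I : Submodule A A) (hI : ∀ a ∈ I, LinearMap.trace K V (Algebra.lsmul K K V a) = 0)
    (S : Submodule A V) [IsSimpleModule A S] {a : A} (ha : a ∈ I) {s : V} (hs : s ∈ S) :
    a • s = 0 := by
  by_contra hne
  have hs0 : s ≠ 0 := by rintro rfl; simp at hne
  have hne' : (⟨a • s, S.smul_mem a hs⟩ : S) ≠ 0 := by simpa [Subtype.ext_iff] using hne
  -- By simplicity `a • s` generates `S`, so some `b * a` fixes `s`; polynomial multiples of `b * a`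
  -- stay in the left ideal `I`.
  obtain ⟨b, hb⟩ := IsSimpleModule.toSpanSingleton_surjective A hne' ⟨s, hs⟩
  have hb' : b • a • s = s := by simpa [Subtype.ext_iff] using hb
  obtain ⟨p, hp⟩ := Module.End.exists_trace_aeval_mul_ne_zero (Algebra.lsmul K K V (b * a)) hs0
    (by simpa [mul_smul] using hb')
  refine hp ?_
  rw [Polynomial.aeval_algHom_apply, ← map_mul]
  exact hI _ (I.smul_mem _ (I.smul_mem b ha))

/-- If everything in the kernel of `φ` annihilates the simple module `S`, then `S` maps nontrivially
to the target of `φ`. -/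
theorem exists_semilinearMap_ne_zero {A S M : Type*} [Ring A] {σ : A →+* A} [RingHomSurjective σ]
    [AddCommGroup S] [Module A S] [IsSimpleModule A S] [AddCommGroup M] [Module A M]
    [IsSemisimpleModule A M] (φ : A →ₛₗ[σ] M) (h : ∀ a, φ a = 0 → ∀ s : S, a • s = 0) :
    ∃ f : S →ₛₗ[σ] M, f ≠ 0 := by
  have := IsSimpleModule.nontrivial A S
  obtain ⟨s, hs⟩ := exists_ne (0 : S)
  set ψ : A →ₗ[A] S := LinearMap.toSpanSingleton A S s
  have hψ : Function.Surjective ψ := IsSimpleModule.toSpanSingleton_surjective A hs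
  -- Projecting `φ` along `K` makes it vanish on `ker ψ`, hence descend to `S`. It is nonzero:
  -- otherwise `φ 1 = φ a` with `a • s = 0`, and `1 - a` would kill `s`.
  set K : Submodule A M := (LinearMap.ker ψ).map φ
  obtain ⟨K', hK'⟩ := exists_isCompl K
  set e := K.quotientEquivOfIsCompl K' hK'
  set g : A →ₛₗ[σ] M := (K'.subtype ∘ₗ e.toLinearMap ∘ₗ K.mkQ).comp φ
  have hg : ∀ a, g a = 0 ↔ φ a ∈ K := by
    intro a
    simp [g]
  have hle : LinearMap.ker ψ ≤ LinearMap.ker g := fun a ha =>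
    LinearMap.mem_ker.2 <| (hg a).2 (Submodule.mem_map_of_mem ha)
  refine ⟨((LinearMap.ker ψ).liftQ g hle).comp
    (ψ.quotKerEquivOfSurjective hψ).symm.toLinearMap, fun h0 => ?_⟩
  have h1 : g 1 = 0 := by
    have := LinearMap.congr_fun h0 (ψ.quotKerEquivOfSurjective hψ (Submodule.Quotient.mk 1))
    simpa using this
  rw [hg] at h1
  obtain ⟨a, ha, ha1⟩ := h1
  have h2 := h (1 - a) (by rw [map_sub, ha1, sub_self]) s
  have h3 : a • s = 0 := by simpa [ψ] using ha
  rw [sub_smul, h3, one_smul, sub_zero] at h2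
  exact hs h2

/-! ### Semilinear fourth roots of the identity from trace invariance -/

/-- `V` carries a `σ`-semilinear automorphism whose fourth power is the identity. -/
def HasFourthRootOfOne {A : Type*} [Ring A] (σ : A →+* A) (V : Type*) [AddCommGroup V] [Module A V] : Prop :=
  ∃ T : V →ₛₗ[σ] V, ∀ v, T (T (T (T v))) = v

lemma HasFourthRootOfOne.congr {A : Type*} [Ring A] {σ : A →+* A} {V W : Type*} [AddCommGroup V] [Module A V] [AddCommGroup W]
    [Module A W] (e : V ≃ₗ[A] W) (h : HasFourthRootOfOne σ V) : HasFourthRootOfOne σ W := by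
  obtain ⟨T, hT⟩ := h
  exact ⟨e.toLinearMap.comp (T.comp e.symm.toLinearMap), fun v => by simp [hT]⟩

lemma HasFourthRootOfOne.prod {A : Type*} [Ring A] {σ : A →+* A} {V W : Type*} [AddCommGroup V] [Module A V] [AddCommGroup W]
    [Module A W] (hV : HasFourthRootOfOne σ V) (hW : HasFourthRootOfOne σ W) :
    HasFourthRootOfOne σ (V × W) := by
  obtain ⟨T, hT⟩ := hV
  obtain ⟨U, hU⟩ := hW
  refine ⟨{ toFun := fun p => (T p.1, U p.2), map_add' := ?_, map_smul' := ?_ }, fun v => ?_⟩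
  · intro p q; simp
  · intro a p; simp
  · simp [hT, hU]

section Semilinear

variable {A : Type*} [Ring A] [Algebra ℂ A] (σ : A →+* A)

/-- The real trace of the action of `A` on `V` is invariant under `σ`. -/
def TraceInvariant (V : Type*) [AddCommGroup V] [Module ℂ V] [Module A V] [IsScalarTower ℂ A V] :
    Prop :=
  ∀ a : A, LinearMap.trace ℝ V (Algebra.lsmul ℝ ℝ V (σ a)) =
    LinearMap.trace ℝ V (Algebra.lsmul ℝ ℝ V a)

variable {σ}

variable {V : Type*} [AddCommGroup V] [Module ℂ V] [Module A V] [IsScalarTower ℂ A V]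

lemma semilinear_map_complex_smul (hσ : ∀ c : ℂ, σ (algebraMap ℂ A c) =
      algebraMap ℂ A (starRingEnd ℂ c))
    {W : Type*} [AddCommGroup W] [Module ℂ W] [Module A W] [IsScalarTower ℂ A W]
    (T : V →ₛₗ[σ] W) (c : ℂ) (v : V) : T (c • v) = starRingEnd ℂ c • T v := by
  rw [← algebraMap_smul A c v, map_smulₛₗ, hσ, algebraMap_smul]

/-- `T` conjugates the action of `a` into that of `σ a`. Since `T` is only real-linear, the traces
are taken over ℝ. -/
lemma HasFourthRootOfOne.traceInvariant (hσ : ∀ c : ℂ, σ (algebraMap ℂ A c) =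
      algebraMap ℂ A (starRingEnd ℂ c)) (h : HasFourthRootOfOne σ V) : TraceInvariant σ V := by
  obtain ⟨T, hT⟩ := h
  intro a
  let e : V ≃ₗ[ℝ] V :=
    { toFun := T
      map_add' := map_add T
      map_smul' := fun r v => by
        rw [← Complex.coe_smul r v, semilinear_map_complex_smul hσ T, Complex.conj_ofReal,
          Complex.coe_smul, RingHom.id_apply]
      invFun := fun v => T (T (T v))
      left_inv := hT
      right_inv := hT }
  rw [← LinearMap.trace_conj' (Algebra.lsmul ℝ ℝ V a) e]
  congr 1
  ext v
  change σ a • v = T (a • T (T (T v)))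
  rw [map_smulₛₗ, hT]

lemma trace_lsmul_congr {W : Type*} [AddCommGroup W] [Module ℂ W] [Module A W]
    [IsScalarTower ℂ A W] (e : V ≃ₗ[A] W) (a : A) :
    LinearMap.trace ℝ W (Algebra.lsmul ℝ ℝ W a) = LinearMap.trace ℝ V (Algebra.lsmul ℝ ℝ V a) := by
  rw [← LinearMap.trace_conj' (Algebra.lsmul ℝ ℝ V a) (e.restrictScalars ℝ)]
  congr 1
  ext v
  change a • v = e (a • e.symm v)
  simp

lemma trace_lsmul_prod [FiniteDimensional ℂ V] {W : Type*} [AddCommGroup W] [Module ℂ W]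
    [Module A W] [IsScalarTower ℂ A W] [FiniteDimensional ℂ W] (a : A) :
    LinearMap.trace ℝ (V × W) (Algebra.lsmul ℝ ℝ (V × W) a) =
      LinearMap.trace ℝ V (Algebra.lsmul ℝ ℝ V a) +
        LinearMap.trace ℝ W (Algebra.lsmul ℝ ℝ W a) := by
  rw [← LinearMap.trace_prodMap']
  rfl

/-- Invariance of the trace passes to complements of invariant summands. -/
lemma TraceInvariant.of_isCompl [FiniteDimensional ℂ V] {W C : Submodule A V} (hWC : IsCompl W C)
    (hV : TraceInvariant σ V) (hW : TraceInvariant σ W) : TraceInvariant σ C := by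
  have : FiniteDimensional ℂ W := inferInstanceAs (FiniteDimensional ℂ (W.restrictScalars ℂ))
  have : FiniteDimensional ℂ C := inferInstanceAs (FiniteDimensional ℂ (C.restrictScalars ℂ))
  intro a
  have h := hV a
  rw [trace_lsmul_congr (W.prodEquivOfIsCompl C hWC), trace_lsmul_congr
    (W.prodEquivOfIsCompl C hWC), trace_lsmul_prod, trace_lsmul_prod, hW a] at h
  exact add_left_cancel h

variable [RingHomInvPair σ σ]

/-- A simple submodule of a semisimple module with invariant trace maps semilinearly to it. -/
lemma exists_semilinearMap_of_traceInvariant [FiniteDimensional ℂ V] [IsSemisimpleModule A V]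
    (hV : TraceInvariant σ V) (S : Submodule A V) [IsSimpleModule A S] :
    ∃ f : S →ₛₗ[σ] V, f ≠ 0 := by
  let b := Module.finBasis ℂ V
  -- Acting on a basis turns the annihilator of `V`, twisted by `σ`, into the kernel of one
  -- semilinear map.
  let φ : A →ₛₗ[σ] (Fin (Module.finrank ℂ V) → V) :=
    { toFun := fun a i => σ a • b i
      map_add' := fun x y => by ext i; simp [add_smul]
      map_smul' := fun x y => by ext i; simp [mul_smul] }
  have hφ : ∀ a, φ a = 0 → ∀ v : V, σ a • v = 0 := by
    intro a ha v
    have h1 : Algebra.lsmul ℂ ℂ V (σ a) = 0 := b.ext fun i => congrFun ha i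
    exact LinearMap.congr_fun h1 v
  obtain ⟨f, hf⟩ := exists_semilinearMap_ne_zero (S := S) φ (fun a ha s => by
    have hz := smul_eq_zero_of_trace_eq_zero (K := ℝ) (V := V) (LinearMap.ker φ)
      (fun a ha => by
        rw [← hV a]
        have : Algebra.lsmul ℝ ℝ V (σ a) = 0 := LinearMap.ext (hφ a ha)
        rw [this, map_zero]) S (a := a) ha s.2
    exact Subtype.ext hz)
  by_contra! hcon
  refine hf (LinearMap.ext fun s => funext fun i => ?_)
  exact LinearMap.congr_fun (hcon ((LinearMap.proj i : _ →ₗ[A] V).comp f)) s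

/-- A nonzero semilinear endomorphism of a simple module can be rescaled to a fourth root of
the identity. -/
lemma HasFourthRootOfOne.of_isSimpleModule (hσ : ∀ c : ℂ, σ (algebraMap ℂ A c) =
      algebraMap ℂ A (starRingEnd ℂ c)) [FiniteDimensional ℂ V] [IsSimpleModule A V]
    (T : V →ₛₗ[σ] V) (hT : Function.Injective T) : HasFourthRootOfOne σ V := by
  have := IsSimpleModule.nontrivial A V
  let F : V →ₗ[A] V := T.comp T
  -- Schur's lemma: `T²` is a scalar `c`, and `c` is real because `T` commutes with `T²`.
  obtain ⟨c, hc⟩ := Module.End.exists_eigenvalue (F.restrictScalars ℂ)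
  obtain ⟨v, hv⟩ := hc.exists_hasEigenvector
  have hF : ∀ w, F w = c • w := by
    intro w
    obtain ⟨a, rfl⟩ := IsSimpleModule.toSpanSingleton_surjective A hv.2 w
    have h1 : F v = c • v := hv.apply_eq_smul
    simp [h1, smul_comm a c v]
  have hTT : ∀ w, T (T w) = c • w := hF
  have hTv : T v ≠ 0 := fun h => hv.2 (hT (by rw [h, map_zero]))
  have hconj : starRingEnd ℂ c = c := by
    have h1 : T (T (T v)) = starRingEnd ℂ c • T v := by
      rw [hTT v, semilinear_map_complex_smul hσ]
    rw [hTT (T v)] at h1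
    exact (smul_left_injective ℂ hTv h1).symm
  have hc0 : c ≠ 0 := by
    rintro rfl
    exact hv.2 (hT (hT (by rw [hTT, zero_smul, map_zero, map_zero])))
  obtain ⟨x, rfl⟩ := Complex.conj_eq_iff_real.1 hconj
  have hx : x ≠ 0 := by exact_mod_cast hc0
  -- Scaling `T` by the real number `r` scales `T²` by `r²`, leaving only the sign of `x`.
  set r : ℝ := (√|x|)⁻¹
  have hr : (r * r * x) * (r * r * x) = 1 := by
    have h1 : r * r = |x|⁻¹ := by
      rw [← mul_inv, Real.mul_self_sqrt (abs_nonneg x)]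
    rw [h1, mul_mul_mul_comm, ← mul_inv, abs_mul_abs_self]
    exact inv_mul_cancel₀ (mul_ne_zero hx hx)
  let U : V →ₛₗ[σ] V :=
    { toFun := fun v => (r : ℂ) • T v
      map_add' := fun v w => by simp
      map_smul' := fun a v => by rw [map_smulₛₗ, smul_comm] }
  have hU : ∀ w, U (U w) = ((r * r * x : ℝ) : ℂ) • w := by
    intro w
    change (r : ℂ) • T ((r : ℂ) • T w) = _
    rw [semilinear_map_complex_smul hσ, hTT, Complex.conj_ofReal, smul_smul, smul_smul]
    push_cast
    rfl
  refine ⟨U, fun w => ?_⟩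
  rw [hU w, hU, smul_smul, ← Complex.ofReal_mul, hr, Complex.ofReal_one, one_smul]

/-- A nontrivial semisimple module with invariant trace has a nontrivial summand carrying a
semilinear fourth root of the identity. -/
lemma exists_submodule_hasFourthRootOfOne (hσ : ∀ c : ℂ, σ (algebraMap ℂ A c) =
      algebraMap ℂ A (starRingEnd ℂ c)) [FiniteDimensional ℂ V] [IsSemisimpleModule A V]
    [Nontrivial V] (hV : TraceInvariant σ V) :
    ∃ W : Submodule A V, W ≠ ⊥ ∧ HasFourthRootOfOne σ W := by
  obtain ⟨S, hS⟩ := IsSemisimpleModule.exists_simple_submodule A V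
  have hSbot : S ≠ ⊥ := (isSimpleModule_iff_isAtom.1 hS).1
  have : FiniteDimensional ℂ S := inferInstanceAs (FiniteDimensional ℂ (S.restrictScalars ℂ))
  obtain ⟨f, hf⟩ := exists_semilinearMap_of_traceInvariant hV S
  have hker : LinearMap.ker f = ⊥ :=
    (eq_bot_or_eq_top (LinearMap.ker f)).resolve_right fun h => hf (LinearMap.ker_eq_top.1 h)
  have hinj : Function.Injective f := LinearMap.ker_eq_bot.1 hker
  by_cases hfS : ∀ s, f s ∈ S
  · exact ⟨S, hSbot, HasFourthRootOfOne.of_isSimpleModule hσ (f.codRestrict S hfS)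
      fun s t h => hinj (congrArg Subtype.val h)⟩
  -- If `f` does not preserve `S`, simplicity makes `S` and `range f` disjoint; `e` and `e.symm`
  -- then exchange the two summands.
  let e : S ≃ₛₗ[σ] LinearMap.range f := LinearEquiv.ofInjective f hinj
  have hdisj : Disjoint S (LinearMap.range f) := by
    rw [disjoint_iff]
    have hcomap : S.comap f = ⊥ := (eq_bot_or_eq_top (S.comap f)).resolve_right fun h => hfS
      fun s => Submodule.mem_comap.1 (h ▸ Submodule.mem_top)
    rw [eq_bot_iff]
    rintro _ ⟨hs, t, rfl⟩
    have ht : t ∈ S.comap f := hs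
    rw [hcomap, Submodule.mem_bot] at ht
    rw [ht, map_zero]
    exact Submodule.zero_mem _
  let j : (S × LinearMap.range f) →ₗ[A] V := S.subtype.coprod (LinearMap.range f).subtype
  have hj : Function.Injective j := by
    rw [← LinearMap.ker_eq_bot]
    rw [LinearMap.ker_coprod_of_disjoint_range _ _ (by simpa using hdisj)]
    simp
  refine ⟨LinearMap.range j, fun h => hSbot ?_, ?_⟩
  · rw [eq_bot_iff, ← h]
    exact fun s hs => ⟨(⟨s, hs⟩, 0), by simp [j]⟩
  · refine HasFourthRootOfOne.congr (LinearEquiv.ofInjective j hj)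
      ⟨{ toFun := fun p => (e.symm p.2, e p.1), map_add' := ?_, map_smul' := ?_ }, fun v => ?_⟩
    · intro p q; simp
    · intro a p; simp [map_smulₛₗ]
    · simp

/-- A semisimple module with invariant trace carries a semilinear fourth root of the identity. -/
theorem TraceInvariant.hasFourthRootOfOne (hσ : ∀ c : ℂ, σ (algebraMap ℂ A c) =
      algebraMap ℂ A (starRingEnd ℂ c)) {V : Type*} [AddCommGroup V] [Module ℂ V] [Module A V]
    [IsScalarTower ℂ A V] [FiniteDimensional ℂ V] [IsSemisimpleModule A V]
    (hV : TraceInvariant σ V) : HasFourthRootOfOne σ V := by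
  induction hd : Module.finrank ℂ V using Nat.strong_induction_on generalizing V with
  | _ d ih =>
    rcases subsingleton_or_nontrivial V with hs | hn
    · exact ⟨0, fun v => Subsingleton.elim _ _⟩
    obtain ⟨W, hW0, hW⟩ := exists_submodule_hasFourthRootOfOne hσ hV
    obtain ⟨C, hC⟩ := exists_isCompl W
    have : FiniteDimensional ℂ C := inferInstanceAs (FiniteDimensional ℂ (C.restrictScalars ℂ))
    have hlt : Module.finrank ℂ C < d := by
      rw [← hd]
      refine Submodule.finrank_lt (s := C.restrictScalars ℂ) fun h => hW0 ?_
      have hCtop : C = ⊤ := by simpa using h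
      exact hC.disjoint.eq_bot_of_le (hCtop ▸ le_top)
    have hCT := ih _ hlt (TraceInvariant.of_isCompl hC hV (hW.traceInvariant hσ)) rfl
    exact (hW.prod hCT).congr (W.prodEquivOfIsCompl C hC)

end Semilinear

/-! ### Real and quaternionic structures and their adapted bases -/

open Quaternion in
/-- A conjugate-linear `T` with `T² = -1` turns a complex space into a quaternionic one,
with `T` acting as the quaternion `j`. -/
@[reducible] noncomputable def quaternionModule {V : Type*} [AddCommGroup V] [Module ℂ V]
    (T : V →ₛₗ[starRingEnd ℂ] V) (hT : ∀ v, T (T v) = -v) : Module ℍ[ℝ] V where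
  smul q v := (⟨q.re, q.imI⟩ : ℂ) • v + (⟨q.imJ, q.imK⟩ : ℂ) • T v
  one_smul v := by
    change (⟨1, 0⟩ : ℂ) • v + (⟨0, 0⟩ : ℂ) • T v = v
    rw [show (⟨1, 0⟩ : ℂ) = 1 from rfl, show (⟨0, 0⟩ : ℂ) = 0 from rfl]
    simp
  mul_smul p q v := by
    change (⟨(p * q).re, (p * q).imI⟩ : ℂ) • v + (⟨(p * q).imJ, (p * q).imK⟩ : ℂ) • T v =
      (⟨p.re, p.imI⟩ : ℂ) • ((⟨q.re, q.imI⟩ : ℂ) • v + (⟨q.imJ, q.imK⟩ : ℂ) • T v) +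
      (⟨p.imJ, p.imK⟩ : ℂ) • T ((⟨q.re, q.imI⟩ : ℂ) • v + (⟨q.imJ, q.imK⟩ : ℂ) • T v)
    -- Quaternions are written z + w j with z, w complex; multiplication follows from j z = z̄ j and
    -- j² = -1.
    have h1 : (⟨(p * q).re, (p * q).imI⟩ : ℂ) = ⟨p.re, p.imI⟩ * ⟨q.re, q.imI⟩ -
        ⟨p.imJ, p.imK⟩ * starRingEnd ℂ ⟨q.imJ, q.imK⟩ := by
      apply Complex.ext <;> simp <;> ring
    have h2 : (⟨(p * q).imJ, (p * q).imK⟩ : ℂ) = ⟨p.re, p.imI⟩ * ⟨q.imJ, q.imK⟩ +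
        ⟨p.imJ, p.imK⟩ * starRingEnd ℂ ⟨q.re, q.imI⟩ := by
      apply Complex.ext <;> simp <;> ring
    rw [h1, h2, map_add, map_smulₛₗ, map_smulₛₗ, hT]
    module
  smul_zero q := by
    change (_ : ℂ) • (0 : V) + (_ : ℂ) • T 0 = 0
    simp
  smul_add q v w := by
    change (_ : ℂ) • (v + w) + (_ : ℂ) • T (v + w) =
      ((_ : ℂ) • v + (_ : ℂ) • T v) + ((_ : ℂ) • w + (_ : ℂ) • T w)
    rw [map_add]
    module
  add_smul p q v := by
    change (⟨p.re + q.re, p.imI + q.imI⟩ : ℂ) • v + (⟨p.imJ + q.imJ, p.imK + q.imK⟩ : ℂ) • T v =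
      ((⟨p.re, p.imI⟩ : ℂ) • v + (⟨p.imJ, p.imK⟩ : ℂ) • T v) +
      ((⟨q.re, q.imI⟩ : ℂ) • v + (⟨q.imJ, q.imK⟩ : ℂ) • T v)
    rw [show (⟨p.re + q.re, p.imI + q.imI⟩ : ℂ) = ⟨p.re, p.imI⟩ + ⟨q.re, q.imI⟩ from rfl,
      show (⟨p.imJ + q.imJ, p.imK + q.imK⟩ : ℂ) = ⟨p.imJ, p.imK⟩ + ⟨q.imJ, q.imK⟩ from rfl]
    module
  zero_smul v := by
    change (⟨0, 0⟩ : ℂ) • v + (⟨0, 0⟩ : ℂ) • T v = 0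
    rw [show (⟨0, 0⟩ : ℂ) = 0 from rfl]
    simp

open Quaternion in
/-- A complex space with a quaternionic structure has a basis of the form `(bᵢ, -T bᵢ)`. -/
theorem exists_quaternionic_basis {V : Type*} [AddCommGroup V] [Module ℂ V] [FiniteDimensional ℂ V]
    (T : V →ₛₗ[starRingEnd ℂ] V) (hT : ∀ v, T (T v) = -v) :
    ∃ (m : ℕ) (b : Module.Basis (Fin m ⊕ Fin m) ℂ V),
      (∀ i, T (b (.inl i)) = -b (.inr i)) ∧ ∀ i, T (b (.inr i)) = b (.inl i) := by
  let _ := quaternionModule T hT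
  have hsmul : ∀ (q : ℍ[ℝ]) (v : V),
      q • v = (⟨q.re, q.imI⟩ : ℂ) • v + (⟨q.imJ, q.imK⟩ : ℂ) • T v := fun _ _ => rfl
  have : IsScalarTower ℝ ℍ[ℝ] V := ⟨fun r q v => by
    rw [hsmul, hsmul, smul_add, ← Complex.coe_smul, ← Complex.coe_smul, smul_smul, smul_smul]
    congr 2 <;> apply Complex.ext <;> simp⟩
  have : Module.Finite ℍ[ℝ] V := Module.Finite.of_restrictScalars_finite ℝ ℍ[ℝ] V
  let b := Module.finBasis ℍ[ℝ] V
  -- The sign makes the matrix of `T` equal to `matrixJ` rather than its negative.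
  let c : Fin (Module.finrank ℍ[ℝ] V) ⊕ Fin (Module.finrank ℍ[ℝ] V) → V :=
    Sum.elim (fun i => b i) (fun i => -T (b i))
  have hli : LinearIndependent ℂ c := by
    rw [Fintype.linearIndependent_iff]
    intro g hg
    let q : Fin (Module.finrank ℍ[ℝ] V) → ℍ[ℝ] := fun i =>
      ⟨(g (.inl i)).re, (g (.inl i)).im, (-g (.inr i)).re, (-g (.inr i)).im⟩
    have h1 : ∑ i, q i • b i = 0 := by
      rw [← hg, Fintype.sum_sum_type, ← Finset.sum_add_distrib]
      refine Finset.sum_congr rfl fun i _ => ?_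
      rw [hsmul]
      change g (.inl i) • b i + (-g (.inr i)) • T (b i) = g (.inl i) • b i + g (.inr i) • -T (b i)
      module
    have h2 := Fintype.linearIndependent_iff.1 b.linearIndependent _ h1
    rintro (i | i)
    · exact Complex.ext (congrArg (fun q => q.re) (h2 i)) (congrArg (fun q => q.imI) (h2 i))
    · rw [← neg_eq_zero]
      exact Complex.ext (congrArg (fun q => q.imJ) (h2 i)) (congrArg (fun q => q.imK) (h2 i))
  have hspan : ⊤ ≤ Submodule.span ℂ (Set.range c) := by
    intro v _
    rw [← b.sum_repr v]
    refine Submodule.sum_mem _ fun i _ => ?_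
    rw [hsmul]
    refine Submodule.add_mem _ (Submodule.smul_mem _ _ (Submodule.subset_span ⟨.inl i, rfl⟩))
      (Submodule.smul_mem _ _ ?_)
    rw [← neg_neg (T (b i))]
    exact Submodule.neg_mem _ (Submodule.subset_span ⟨.inr i, rfl⟩)
  refine ⟨_, Module.Basis.mk hli hspan, fun i => ?_, fun i => ?_⟩
  · simp [Module.Basis.mk_apply, c]
  · simp [Module.Basis.mk_apply, c, hT]

/-- A complex space with a real structure has a basis of real vectors. -/
theorem exists_real_basis {V : Type*} [AddCommGroup V] [Module ℂ V] [FiniteDimensional ℂ V]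
    (T : V →ₛₗ[starRingEnd ℂ] V) (hT : ∀ v, T (T v) = v) :
    ∃ (r : ℕ) (b : Module.Basis (Fin r) ℂ V), ∀ i, T (b i) = b i := by
  let F : Submodule ℝ V :=
    { carrier := {v | T v = v}
      add_mem' := fun {v w} hv hw => by
        change T (v + w) = v + w
        rw [map_add, hv, hw]
      zero_mem' := map_zero T
      smul_mem' := fun r v hv => by
        change T (r • v) = r • v
        rw [← Complex.coe_smul, map_smulₛₗ, hv, Complex.conj_ofReal] }
  have hF : ∀ {v}, v ∈ F → T v = v := fun hv => hv
  let b := Module.finBasis ℝ F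
  let c : Fin (Module.finrank ℝ F) → V := fun i => (b i : V)
  have hli : LinearIndependent ℂ c := by
    rw [Fintype.linearIndependent_iff]
    intro g hg
    have h1 : ((∑ i, (g i).re • b i : F) : V) + Complex.I • ((∑ i, (g i).im • b i : F) : V) = 0 := by
      rw [← hg, Submodule.coe_sum, Submodule.coe_sum, Finset.smul_sum, ← Finset.sum_add_distrib]
      refine Finset.sum_congr rfl fun i _ => ?_
      conv_rhs => rw [← Complex.re_add_im (g i)]
      rw [add_smul, mul_comm, mul_smul, Complex.coe_smul, Complex.coe_smul]
      rfl
    set x := ∑ i, (g i).re • b i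
    set y := ∑ i, (g i).im • b i
    -- Applying `T` to x + iy = 0 gives x - iy = 0.
    have h2 := congrArg T h1
    rw [map_add, map_smulₛₗ, hF x.2, hF y.2, map_zero, Complex.conj_I] at h2
    have hx : x = 0 := by
      have h3 : (2 : ℂ) • (x : V) = 0 := by
        calc (2 : ℂ) • (x : V) = (x + Complex.I • (y : V)) + (x + (-Complex.I) • (y : V)) := by
              module
          _ = 0 := by rw [h1, h2, add_zero]
      exact Subtype.ext ((smul_eq_zero.1 h3).resolve_left two_ne_zero)
    have hy : y = 0 := by
      rw [hx, Submodule.coe_zero, zero_add] at h1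
      exact Subtype.ext ((smul_eq_zero.1 h1).resolve_left Complex.I_ne_zero)
    intro i
    exact Complex.ext (Fintype.linearIndependent_iff.1 b.linearIndependent _ hx i)
      (Fintype.linearIndependent_iff.1 b.linearIndependent _ hy i)
  have hFspan : ∀ v ∈ F, v ∈ Submodule.span ℂ (Set.range c) := by
    intro v hv
    have h1 : v = ∑ i, b.repr ⟨v, hv⟩ i • (b i : V) := by
      conv_lhs => rw [show v = ((⟨v, hv⟩ : F) : V) from rfl, ← b.sum_repr ⟨v, hv⟩]
      rw [Submodule.coe_sum]
      rfl
    rw [h1]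
    refine Submodule.sum_mem _ fun i _ => ?_
    rw [← Complex.coe_smul]
    exact Submodule.smul_mem _ _ (Submodule.subset_span ⟨i, rfl⟩)
  have hspan : ⊤ ≤ Submodule.span ℂ (Set.range c) := by
    intro v _
    -- Up to the factors 2 and -2, these are the real and imaginary parts of `v`.
    have h1 : v + T v ∈ F := by
      change T (v + T v) = v + T v
      rw [map_add, hT, add_comm]
    have h2 : Complex.I • (v - T v) ∈ F := by
      change T (Complex.I • (v - T v)) = Complex.I • (v - T v)
      rw [map_smulₛₗ, map_sub, hT, Complex.conj_I]
      module
    have h3 : v = (1 / 2 : ℂ) • (v + T v) - (Complex.I / 2) • (Complex.I • (v - T v)) := by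
      rw [smul_smul, div_mul_eq_mul_div, Complex.I_mul_I]
      module
    rw [h3]
    exact Submodule.sub_mem _ (Submodule.smul_mem _ _ (hFspan _ h1))
      (Submodule.smul_mem _ _ (hFspan _ h2))
  exact ⟨_, Module.Basis.mk hli hspan, fun i => by rw [Module.Basis.mk_apply]; exact hF (b i).2⟩

/-- A conjugate-linear `T` with `T⁴ = 1` admits a basis adapted to its real and quaternionic
parts. -/
theorem exists_real_quaternionic_basis {V : Type*} [AddCommGroup V] [Module ℂ V]
    [FiniteDimensional ℂ V] (T : V →ₛₗ[starRingEnd ℂ] V) (hT : ∀ v, T (T (T (T v))) = v) :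
    ∃ (r m : ℕ) (b : Module.Basis (Fin r ⊕ (Fin m ⊕ Fin m)) ℂ V),
      (∀ i, T (b (.inl i)) = b (.inl i)) ∧
      (∀ i, T (b (.inr (.inl i))) = -b (.inr (.inr i))) ∧
      ∀ i, T (b (.inr (.inr i))) = b (.inr (.inl i)) := by
  let F : V →ₗ[ℂ] V := T.comp T
  let R := LinearMap.ker (F - LinearMap.id)
  let H := LinearMap.ker (F + LinearMap.id)
  have hR : ∀ v, v ∈ R ↔ T (T v) = v := fun v => by
    rw [LinearMap.mem_ker, LinearMap.sub_apply, sub_eq_zero]; rfl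
  have hH : ∀ v, v ∈ H ↔ T (T v) = -v := fun v => by
    rw [LinearMap.mem_ker, LinearMap.add_apply, add_eq_zero_iff_eq_neg]; rfl
  have hcompl : IsCompl R H := by
    constructor
    · rw [Submodule.disjoint_def]
      intro v h1 h2
      rw [hR] at h1
      rw [hH, h1] at h2
      have h3 : (2 : ℂ) • v = 0 := by
        rw [two_smul]
        nth_rw 1 [h2]
        exact neg_add_cancel v
      exact (smul_eq_zero.1 h3).resolve_left two_ne_zero
    · rw [codisjoint_iff_le_sup]
      intro v _
      refine Submodule.mem_sup.2 ⟨(1 / 2 : ℂ) • (v + T (T v)), R.smul_mem _ ?_,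
        (1 / 2 : ℂ) • (v - T (T v)), H.smul_mem _ ?_, by module⟩
      · rw [hR, map_add, map_add, hT, add_comm]
      · rw [hH, map_sub, map_sub, hT, neg_sub]
  let TR : R →ₛₗ[starRingEnd ℂ] R := (T.comp R.subtype).codRestrict R fun v =>
    (hR _).2 (congrArg T ((hR _).1 v.2))
  let TH : H →ₛₗ[starRingEnd ℂ] H := (T.comp H.subtype).codRestrict H fun v =>
    (hH _).2 ((congrArg T ((hH _).1 v.2)).trans (map_neg T _))
  obtain ⟨r, b, hb⟩ := exists_real_basis TR fun v => Subtype.ext ((hR _).1 v.2)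
  obtain ⟨m, c, hc, hc'⟩ := exists_quaternionic_basis TH fun v => Subtype.ext ((hH _).1 v.2)
  refine ⟨r, m, (b.prod c).map (R.prodEquivOfIsCompl H hcompl), fun i => ?_, fun i => ?_,
    fun i => ?_⟩
  · have h : T (b i) = b i := congrArg Subtype.val (hb i)
    simpa using h
  · have h : T (c (.inl i)) = -(c (.inr i) : V) := congrArg Subtype.val (hc i)
    simpa using h
  · have h : T (c (.inr i)) = c (.inl i) := congrArg Subtype.val (hc' i)
    simpa using h

/-! ### Matrices commuting with the structure map -/

/-- If `f` commutes with the conjugate-linear map `T` with matrix `K`, then its matrix `M` satisfies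
`M K = K conj M`. -/
theorem toMatrix_mul_eq_of_commute {ι V : Type*} [Fintype ι] [DecidableEq ι] [AddCommGroup V]
    [Module ℂ V] (b : Module.Basis ι ℂ V) (T : V →ₛₗ[starRingEnd ℂ] V) (K : Matrix ι ι ℂ)
    (hK : ∀ j, T (b j) = ∑ k, K k j • b k) (f : V →ₗ[ℂ] V) (hf : ∀ v, T (f v) = f (T v)) :
    LinearMap.toMatrix b b f * K = K * (LinearMap.toMatrix b b f).map (starRingEnd ℂ) := by
  set M := LinearMap.toMatrix b b f
  have hM : ∀ j, f (b j) = ∑ k, M k j • b k := fun j => by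
    conv_lhs => rw [← b.sum_repr (f (b j))]
    simp [M, LinearMap.toMatrix_apply]
  ext i j
  have h := hf (b j)
  rw [hM, hK, map_sum, map_sum] at h
  simp only [map_smulₛₗ, hK, hM, RingHom.id_apply] at h
  have h1 := congrArg (fun v => b.repr v i) h
  simp only [map_sum, map_smul, Finsupp.coe_finsetSum, Finset.sum_apply, Finsupp.smul_apply,
    Module.Basis.repr_self, smul_eq_mul, Finsupp.single_apply, mul_ite, mul_one, mul_zero,
    Finset.sum_ite_eq', Finset.mem_univ, if_true] at h1
  simp only [Matrix.mul_apply, Matrix.map_apply]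
  rw [Finset.sum_congr rfl fun k _ => mul_comm (M i k) (K k j), ← h1]
  exact Finset.sum_congr rfl fun k _ => mul_comm _ _

lemma matrixJ_mul_self (m : ℕ) : matrixJ m * matrixJ m = -1 := by
  rw [matrixJ, Matrix.fromBlocks_multiply, ← Matrix.fromBlocks_one, Matrix.fromBlocks_neg]
  simp

lemma matrixJ_map_conj (m : ℕ) : (matrixJ m).map (starRingEnd ℂ) = matrixJ m := by
  rw [matrixJ, Matrix.fromBlocks_map]
  congr 1 <;> ext i j <;> simp [Matrix.one_apply, apply_ite]

/-- Matrices `M` with `M K = K conj M`, for `K` the block diagonal matrix with blocks `1` and `J`,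
are block diagonal with a real and a quaternionic block. -/
theorem blocks_of_mul_eq_mul_conj {r m : ℕ}
    {M : Matrix (Fin r ⊕ (Fin m ⊕ Fin m)) (Fin r ⊕ (Fin m ⊕ Fin m)) ℂ}
    (h : M * Matrix.fromBlocks 1 0 0 (matrixJ m) =
      Matrix.fromBlocks 1 0 0 (matrixJ m) * M.map (starRingEnd ℂ)) :
    M = Matrix.fromBlocks M.toBlocks₁₁ 0 0 M.toBlocks₂₂ ∧
      (M.toBlocks₁₁.map Complex.re).map Complex.ofReal = M.toBlocks₁₁ ∧
      M.toBlocks₂₂ * matrixJ m = matrixJ m * M.toBlocks₂₂.map (starRingEnd ℂ) := by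
  obtain ⟨M₁₁, M₁₂, M₂₁, M₂₂, rfl⟩ : ∃ A B C D, M = Matrix.fromBlocks A B C D :=
    ⟨_, _, _, _, (Matrix.fromBlocks_toBlocks M).symm⟩
  simp only [Matrix.fromBlocks_multiply, Matrix.fromBlocks_map, Matrix.mul_one, Matrix.mul_zero,
    Matrix.one_mul, Matrix.zero_mul, add_zero, zero_add, Matrix.fromBlocks_inj] at h
  obtain ⟨h11, h12, h21, h22⟩ := h
  have hconj : ∀ {ι κ : Type} (X : Matrix ι κ ℂ),
      (X.map (starRingEnd ℂ)).map (starRingEnd ℂ) = X := fun X => by ext; simp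
  have neg_self : ∀ {ι κ : Type} {X : Matrix ι κ ℂ}, X = -X → X = 0 := fun {_ _ X} hX => by
    ext i j
    exact self_eq_neg.1 (congrFun (congrFun hX i) j)
  -- An off-diagonal block intertwines a structure of square 1 with one of square -1; using its
  -- relation twice shows it equals its negative.
  have z12 : M₁₂ = 0 := by
    apply neg_self
    calc M₁₂ = (M₁₂.map (starRingEnd ℂ)).map (starRingEnd ℂ) := (hconj _).symm
      _ = M₁₂ * (matrixJ m * matrixJ m) := by
        rw [← h12, Matrix.map_mul, matrixJ_map_conj, ← h12, Matrix.mul_assoc]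
      _ = -M₁₂ := by rw [matrixJ_mul_self, Matrix.mul_neg, Matrix.mul_one]
  have z21 : M₂₁ = 0 := by
    apply neg_self
    calc M₂₁ = matrixJ m * M₂₁.map (starRingEnd ℂ) := h21
      _ = (matrixJ m * matrixJ m) * M₂₁ := by
        conv_lhs => rw [h21]
        rw [Matrix.map_mul, matrixJ_map_conj, hconj, Matrix.mul_assoc]
      _ = -M₂₁ := by rw [matrixJ_mul_self, Matrix.neg_mul, Matrix.one_mul]
  subst z12 z21
  simp only [Matrix.toBlocks_fromBlocks₁₁, Matrix.toBlocks_fromBlocks₂₂, true_and]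
  refine ⟨?_, h22⟩
  ext i j
  exact Complex.conj_eq_iff_re.1 (congrFun (congrFun h11 i) j).symm

/-- A matrix representation satisfying `M K = K conj M`, for `K` the block diagonal matrix with
blocks `1` and `J`, is a direct sum of a real and a quaternionic representation. -/
theorem exists_real_quaternionic_hom {Γ : Type*} [Group Γ] {r m : ℕ}
    (N : Γ →* Matrix (Fin r ⊕ (Fin m ⊕ Fin m)) (Fin r ⊕ (Fin m ⊕ Fin m)) ℂ)
    (h : ∀ γ, N γ * Matrix.fromBlocks 1 0 0 (matrixJ m) =
      Matrix.fromBlocks 1 0 0 (matrixJ m) * (N γ).map (starRingEnd ℂ)) :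
    ∃ (ρ' : Γ →* Matrix.GeneralLinearGroup (Fin r) ℝ) (ρ'' : Γ →* GLH m), ∀ γ,
      N γ = Matrix.fromBlocks ((ρ' γ).val.map Complex.ofReal) 0 0 (ρ'' γ).val.val := by
  have hb := fun γ => blocks_of_mul_eq_mul_conj (h γ)
  have hone : (1 : Matrix (Fin r ⊕ (Fin m ⊕ Fin m)) (Fin r ⊕ (Fin m ⊕ Fin m)) ℂ) =
    Matrix.fromBlocks 1 0 0 1 := Matrix.fromBlocks_one.symm
  have hmul : ∀ γ δ, (N (γ * δ)).toBlocks₁₁ = (N γ).toBlocks₁₁ * (N δ).toBlocks₁₁ ∧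
      (N (γ * δ)).toBlocks₂₂ = (N γ).toBlocks₂₂ * (N δ).toBlocks₂₂ := by
    intro γ δ
    rw [map_mul]
    conv =>
      congr
      · lhs; rw [(hb γ).1, (hb δ).1]
      · lhs; rw [(hb γ).1, (hb δ).1]
    simp [Matrix.fromBlocks_multiply]
  have hinj : Function.Injective
      (fun X : Matrix (Fin r) (Fin r) ℝ => X.map Complex.ofReal) :=
    Matrix.map_injective Complex.ofReal_injective
  let φ : Γ →* Matrix (Fin r) (Fin r) ℝ :=
    { toFun := fun γ => (N γ).toBlocks₁₁.map Complex.re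
      map_one' := by
        rw [map_one, hone, Matrix.toBlocks_fromBlocks₁₁]
        ext i j
        simp [Matrix.one_apply, apply_ite]
      map_mul' := fun γ δ => hinj <| by
        change _ = Matrix.map (_ * _) Complex.ofRealHom
        rw [Matrix.map_mul]
        change ((N (γ * δ)).toBlocks₁₁.map Complex.re).map Complex.ofReal =
          ((N γ).toBlocks₁₁.map Complex.re).map Complex.ofReal *
            ((N δ).toBlocks₁₁.map Complex.re).map Complex.ofReal
        rw [(hb _).2.1, (hb _).2.1, (hb _).2.1, (hmul γ δ).1] }
  let ψ : Γ →* Matrix (Fin m ⊕ Fin m) (Fin m ⊕ Fin m) ℂ :=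
    { toFun := fun γ => (N γ).toBlocks₂₂
      map_one' := by rw [map_one, hone, Matrix.toBlocks_fromBlocks₂₂]
      map_mul' := fun γ δ => (hmul γ δ).2 }
  refine ⟨φ.toHomUnits, ψ.toHomUnits.codRestrict (GLH m) fun γ => (hb γ).2.2, fun γ => ?_⟩
  exact (hb γ).1.trans (congrArg (fun X => Matrix.fromBlocks X 0 0 _) (hb γ).2.1.symm)

/-! ### From fixed characters to trace-invariant modules over the group algebra -/

/-- The real trace of a complex endomorphism is twice the real part of its trace. -/
theorem trace_real_eq {V : Type*} [AddCommGroup V] [Module ℂ V] [FiniteDimensional ℂ V]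
    (f : V →ₗ[ℂ] V) :
    LinearMap.trace ℝ V (f.restrictScalars ℝ) = 2 * (LinearMap.trace ℂ V f).re := by
  let b := Module.finBasis ℂ V
  rw [LinearMap.trace_eq_matrix_trace ℂ b,
    LinearMap.trace_eq_matrix_trace ℝ (Complex.basisOneI.smulTower b), Matrix.trace, Matrix.trace,
    Fintype.sum_prod_type, Fin.sum_univ_two, Complex.re_sum, two_mul]
  -- The real basis consists of the vectors b and ib; each half contributes the real parts of the
  -- diagonal entries.
  congr 1 <;>
  · refine Finset.sum_congr rfl fun i _ => ?_
    simp [LinearMap.toMatrix_apply, Module.Basis.smulTower_repr, Module.Basis.smulTower_apply]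

namespace GLRep

variable {Γ : Type*} [Group Γ] {n : ℕ}

/-- A representation whose character is fixed by `Φ₁` has real traces. -/
lemma conj_trace_of_Phi1_eq {ρ : GLRep Γ n} (h : Phi1 (character ρ) = character ρ) (γ : Γ) :
    starRingEnd ℂ (ρ γ).val.trace = (ρ γ).val.trace := by
  let f : GLRep Γ n → ℂ := fun ρ => (ρ γ).val.trace
  have hf : f ∈ invariantFunctions Γ n := by
    constructor
    · have : f = ∑ i, fun ρ : GLRep Γ n => (ρ γ).val i i := by
        ext ρ
        simp [f, Matrix.trace]
      rw [this]
      exact Subalgebra.sum_mem _ fun i _ => Algebra.subset_adjoin ⟨γ, i, i, rfl⟩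
    · intro P ρ
      exact Matrix.trace_units_conj P (ρ γ).val
  rw [Phi1_character] at h
  have h1 := congrArg (fun χ => χ ⟨f, hf⟩) h
  refine Eq.trans ?_ h1
  change starRingEnd ℂ (∑ i, (ρ γ).val i i) = ∑ i, starRingEnd ℂ ((ρ γ).val i i)
  exact map_sum _ _ _

/-- Complex conjugation of coefficients on the group algebra. -/
noncomputable def conjGroupAlgebra (Γ : Type*) [Group Γ] :
    MonoidAlgebra ℂ Γ →+* MonoidAlgebra ℂ Γ :=
  MonoidAlgebra.mapRingHom Γ (starRingEnd ℂ)

@[simp] lemma conjGroupAlgebra_single (γ : Γ) (c : ℂ) :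
    conjGroupAlgebra Γ (MonoidAlgebra.single γ c) = MonoidAlgebra.single γ (starRingEnd ℂ c) :=
  MonoidAlgebra.mapRingHom_single _ _ _

instance : RingHomInvPair (conjGroupAlgebra Γ) (conjGroupAlgebra Γ) := by
  have h : (conjGroupAlgebra Γ).comp (conjGroupAlgebra Γ) = RingHom.id _ := by
    rw [conjGroupAlgebra, ← MonoidAlgebra.mapRingHom_comp, RingHomInvPair.comp_eq (σ := starRingEnd ℂ),
      MonoidAlgebra.mapRingHom_id]
  exact ⟨h, h⟩

lemma conjGroupAlgebra_algebraMap (c : ℂ) :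
    conjGroupAlgebra Γ (algebraMap ℂ (MonoidAlgebra ℂ Γ) c) =
      algebraMap ℂ (MonoidAlgebra ℂ Γ) (starRingEnd ℂ c) := by
  simp [MonoidAlgebra.coe_algebraMap]

lemma trace_lsmul_single (ρ : GLRep Γ n) (γ : Γ) (c : ℂ) :
    LinearMap.trace ℝ (toRepresentation ρ).asModule
      (Algebra.lsmul ℝ ℝ (toRepresentation ρ).asModule (MonoidAlgebra.single γ c)) =
      2 * (c * (ρ γ).val.trace).re := by
  have h : Algebra.lsmul ℝ ℝ (toRepresentation ρ).asModule (MonoidAlgebra.single γ c) =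
      (c • toRepresentation ρ γ).restrictScalars ℝ :=
    LinearMap.ext fun v => Representation.single_smul _ c γ v
  rw [h]
  refine (trace_real_eq (V := Fin n → ℂ) (c • toRepresentation ρ γ)).trans ?_
  rw [map_smul, smul_eq_mul]
  congr 3
  exact Matrix.trace_toLin'_eq _

/-- By additivity it suffices to treat c·γ, with real trace 2 Re(c tr ρ(γ)); as tr ρ(γ) is real,
conjugating c changes nothing. -/
lemma traceInvariant_asModule {ρ : GLRep Γ n} (h : Phi1 (character ρ) = character ρ) :
    TraceInvariant (conjGroupAlgebra Γ) (toRepresentation ρ).asModule := by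
  intro a
  induction a using MonoidAlgebra.induction_linear with
  | zero => simp
  | add f g hf hg => simp only [map_add, hf, hg]
  | single γ c =>
    rw [conjGroupAlgebra_single, trace_lsmul_single, trace_lsmul_single]
    nth_rw 1 [← conj_trace_of_Phi1_eq h γ]
    rw [← map_mul, Complex.conj_re]

/-- A semisimple representation with character fixed by `Φ₁` commutes with a conjugate-linear
fourth root of the identity. -/
theorem exists_conjLinear_commuting {ρ : GLRep Γ n} (hρ : IsSemisimple ρ)
    (h : Phi1 (character ρ) = character ρ) :
    ∃ T : (Fin n → ℂ) →ₛₗ[starRingEnd ℂ] (Fin n → ℂ), (∀ v, T (T (T (T v))) = v) ∧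
      ∀ γ v, T (Matrix.toLin' (ρ γ).val v) = Matrix.toLin' (ρ γ).val (T v) := by
  have hss : IsSemisimpleModule (MonoidAlgebra ℂ Γ) (toRepresentation ρ).asModule :=
    (Representation.isSemisimpleRepresentation_iff_isSemisimpleModule_asModule _).1 hρ
  obtain ⟨T, hT⟩ := (traceInvariant_asModule h).hasFourthRootOfOne conjGroupAlgebra_algebraMap
  refine ⟨{ toFun := T
            map_add' := map_add T
            map_smul' := semilinear_map_complex_smul conjGroupAlgebra_algebraMap T },
    hT, fun γ v => ?_⟩
  have h1 : ∀ w : (toRepresentation ρ).asModule,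
      MonoidAlgebra.single γ (1 : ℂ) • w = Matrix.toLin' (ρ γ).val w := fun w =>
    (Representation.single_smul _ 1 γ w).trans (one_smul _ _)
  have h2 := map_smulₛₗ T (MonoidAlgebra.single γ (1 : ℂ)) v
  rw [conjGroupAlgebra_single, map_one] at h2
  exact (congrArg T (h1 v)).symm.trans (h2.trans (h1 (T v)))

end GLRep

theorem proposition6p5 {Γ : Type*} [Group Γ] [Group.FG Γ] (n : ℕ) (ρ : GLRep Γ n)
    (hρ : GLRep.IsSemisimple ρ)
    (hfix : GLRep.Phi1 (GLRep.character ρ) = GLRep.character ρ) :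
    ∃ (r₁ r₂ : ℕ) (h : r₁ + 2 * r₂ = n)
      (ρ' : Γ →* Matrix.GeneralLinearGroup (Fin r₁) ℝ) (ρ'' : Γ →* GLH r₂)
      (P : Matrix.GeneralLinearGroup (Fin n) ℂ),
      ∀ γ : Γ, P * ρ γ * P⁻¹ = realQuaternionicSum h ρ' ρ'' γ := by
  obtain ⟨T, hT, hcomm⟩ := GLRep.exists_conjLinear_commuting hρ hfix
  obtain ⟨r, m, b, hb₁, hb₂, hb₃⟩ := exists_real_quaternionic_basis T hT
  have hcard : r + 2 * m = n := by
    have := Module.finrank_eq_card_basis b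
    simp at this
    omega
  let N : Γ →* Matrix (Fin r ⊕ (Fin m ⊕ Fin m)) (Fin r ⊕ (Fin m ⊕ Fin m)) ℂ :=
    { toFun := fun γ => LinearMap.toMatrix b b (Matrix.toLin' (ρ γ).val)
      map_one' := by simp
      map_mul' := fun γ δ => by
        rw [map_mul, Units.val_mul, Matrix.toLin'_mul, LinearMap.toMatrix_comp b b b] }
  have hK : ∀ j, T (b j) = ∑ k, (Matrix.fromBlocks 1 0 0 (matrixJ m) :
      Matrix (Fin r ⊕ (Fin m ⊕ Fin m)) (Fin r ⊕ (Fin m ⊕ Fin m)) ℂ) k j • b k := by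
    rintro (j | j | j)
    · simp [hb₁, Matrix.one_apply]
    · simp [hb₂, matrixJ, Matrix.one_apply]
    · simp [hb₃, matrixJ, Matrix.one_apply]
  obtain ⟨ρ', ρ'', hN⟩ := exists_real_quaternionic_hom N fun γ =>
    toMatrix_mul_eq_of_commute b T _ hK _ (hcomm γ)
  let c : Module.Basis (Fin n) ℂ (Fin n → ℂ) := b.reindex (blockIndexEquiv hcard)
  let s : Module.Basis (Fin n) ℂ (Fin n → ℂ) := Pi.basisFun ℂ (Fin n)
  -- Change of coordinates from the standard basis to the basis adapted to `T`.
  let P : Matrix.GeneralLinearGroup (Fin n) ℂ :=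
    ⟨c.toMatrix s, s.toMatrix c, c.toMatrix_mul_toMatrix_flip s, s.toMatrix_mul_toMatrix_flip c⟩
  refine ⟨r, m, hcard, ρ', ρ'', P, fun γ => Units.ext ?_⟩
  have h1 : (P * ρ γ * P⁻¹).val = LinearMap.toMatrix c c (Matrix.toLin' (ρ γ).val) := by
    rw [← basis_toMatrix_mul_linearMap_toMatrix_mul_basis_toMatrix c s c s,
      LinearMap.toMatrix_eq_toMatrix', LinearMap.toMatrix'_toLin']
    rfl
  have h2 : (realQuaternionicSum hcard ρ' ρ'' γ).val =
      Matrix.reindex (blockIndexEquiv hcard) (blockIndexEquiv hcard) (N γ) := by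
    rw [hN]
    rfl
  rw [h1, h2]
  ext i j
  simp [c, N, LinearMap.toMatrix_apply]
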